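/- Let $\lambda\in\mathbb C$ with $\operatorname{Re}\lambda\ge 1$. For real $t,u$ define recursively $F_1(\lambda;t,u)=e^{itu}$ and, for $N\ge 2$ and $t,u\in\mathbb R^N$, $$F_N(\lambda;t,u)=\frac{e^{iu_N\sum_{j=1}^N t_j}}{(N-1)!}\int_{\mathbb R^{N-1}}\frac{\prod_{1\le j<k\le N-1}[4\sinh^2(s_j-s_k)]^{\lambda}}{\prod_{j=1}^{N}\prod_{k=1}^{N-1}[2\cosh(t_j-s_k)]^{\lambda}}\,F_{N-1}\big(\lambda;s,(u_1-u_N,\dots,u_{N-1}-u_N)\big)\,ds ,$$ where the powers of positive numbers are defined with real logarithms. For $N\ge1$ let $$\mathcal A_N=\{t\in\mathbb C^N:\ |\operatorname{Im}(t_j-t_k)|<\pi\ \text{ for all } 1\le j<k\le N\}.$$ Then, for $\operatorname{Re}\lambda\ge1$ and $u\in\mathbb R^N$, these integrals converge absolutely, and $F_N(\lambda;\cdot,u)$ extends (uniquely) from $\mathbb R^N$ to a holomorphic function on $\mathcal A_N$, again denoted by $F_N(\lambda;\cdot,u)$. For $t\in\mathbb C^N$ let $j_1,\dots,j_N$ be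 an enumeration of $1,\dots,N$ with $\operatorname{Im}t_{j_N}\le\dots\le\operatorname{Im}t_{j_1}$, and put $\phi_N(t)=\tfrac12\operatorname{Im}(t_{j_1}+t_{j_N})$ and $d_N(t)=\operatorname{Im}(t_{j_1}-t_{j_N})$. Theorem. For every $N\ge 1$ there is a continuous function $C$ on $\{\lambda\in\mathbb C:\operatorname{Re}\lambda\ge1\}\times[0,\pi)$ (depending only on $N$) such that for all $u\in\mathbb R^N$, all $\lambda\in\mathbb C$ with $\operatorname{Re}\lambda\ge 1$, all $t\in\mathcal A_N$ and every such enumeration, $$|F_N(\lambda;t,u)|<C(\lambda,d_N(t))\exp\Big(-\Big[\phi_N(t)\sum_{j=1}^N u_j+u_N\sum_{k=2}^{N-1}\big(\operatorname{Im}t_{j_k}-\phi_N(t)\big)\Big]\Big)\prod_{1\le m<n\le N}\frac{\operatorname{Re}(t_m-t_n)}{\sinh\big(\operatorname{Re}\lambda\,\operatorname{Re}(t_m-t_n)\big)},$$ where a factor with $\operatorname{Re}(t_m-t_n)=0$ is read as its limit $1/\operatorname{Re}\lambda$. -/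

import Mathlib

/-! Particle numbers are written `N = n + 1`, and indices `1, …, N` are the elements of
`Fin (n + 1)`; thus `0` is the first index and `Fin.last n` the last one. -/

namespace CalogeroMoser

noncomputable section

/-- The weight function `∏_{j<k} [4 sinh²(s_j - s_k)]^lam` at real points. -/
def weight (lam : ℂ) {m : ℕ} (s : Fin m → ℝ) : ℂ :=
  ∏ j : Fin m, ∏ k ∈ Finset.Ioi j, ((4 * Real.sinh (s j - s k) ^ 2 : ℝ) : ℂ) ^ lam

/-- The kernel function `∏_{j ≤ m+1} ∏_{k ≤ m} [2 cosh(t_j - s_k)]^{-lam}` at real points. -/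
def kernel (lam : ℂ) {m : ℕ} (t : Fin (m + 1) → ℝ) (s : Fin m → ℝ) : ℂ :=
  ∏ j : Fin (m + 1), ∏ k : Fin m, ((2 * Real.cosh (t j - s k) : ℝ) : ℂ) ^ (-lam)

/-- The shifted spectral vector `(u_1 - u_N, …, u_{N-1} - u_N)`. -/
def shift {n : ℕ} (u : Fin (n + 2) → ℝ) : Fin (n + 1) → ℝ :=
  fun j => u j.castSucc - u (Fin.last (n + 1))

/-- The function `F_{n+1}(lam; t, u)` for real `t`, given by the recursion
`F_1(t, u) = exp(i t u)` and
`F_N(t, u) = exp(i u_N ∑ t_j) / (N-1)! ∫_{ℝ^{N-1}} W(s) K(t, s) F_{N-1}(s, shift u) ds`. -/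
def realF (lam : ℂ) : (n : ℕ) → (Fin (n + 1) → ℝ) → (Fin (n + 1) → ℝ) → ℂ
  | 0, t, u => Complex.exp (Complex.I * (t 0 : ℂ) * (u 0 : ℂ))
  | n + 1, t, u =>
      Complex.exp (Complex.I * (u (Fin.last (n + 1)) : ℂ) * ∑ j, (t j : ℂ)) /
          (Nat.factorial (n + 1) : ℂ) *
        ∫ s : Fin (n + 1) → ℝ, weight lam s * kernel lam t s * realF lam n s (shift u)

/-- Absolute convergence of the integral that defines `F_{n+1}(lam; t, u)` at real `t`
(for one particle there is no integral). -/
def DefiningIntegralConverges (lam : ℂ) :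
    (n : ℕ) → (Fin (n + 1) → ℝ) → (Fin (n + 1) → ℝ) → Prop
  | 0, _, _ => True
  | n + 1, t, u =>
      MeasureTheory.Integrable
        (fun s : Fin (n + 1) → ℝ => weight lam s * kernel lam t s * realF lam n s (shift u))

/-- The domain `𝒜_{n+1}` of all `t ∈ ℂ^{n+1}` with `|Im (t_j - t_k)| < π` for all `j < k`. -/
def domainA (n : ℕ) : Set (Fin (n + 1) → ℂ) :=
  {t | ∀ j k, j < k → |(t j - t k).im| < Real.pi}

/-- `G` is holomorphic on `𝒜_{n+1}` and extends `F_{n+1}(lam; ·, u)` from the real points. Since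
`𝒜_{n+1}` is a convex open set that contains `ℝ^{n+1}`, the values of `G` on it are unique. -/
def IsContinuation (lam : ℂ) (n : ℕ) (u : Fin (n + 1) → ℝ) (G : (Fin (n + 1) → ℂ) → ℂ) : Prop :=
  DifferentiableOn ℂ G (domainA n) ∧
    ∀ x : Fin (n + 1) → ℝ, G (fun j => (x j : ℂ)) = realF lam n x u

open Classical in
/-- The function `F_{n+1}(lam; t, u)` for `t ∈ 𝒜_{n+1}`: the holomorphic continuation in `t` of the
recursively defined integral. -/
def F (lam : ℂ) (n : ℕ) (t : Fin (n + 1) → ℂ) (u : Fin (n + 1) → ℝ) : ℂ :=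
  if h : ∃ G, IsContinuation lam n u G then h.choose t else 0

/-- `j` is an enumeration `j_1, …, j_N` of the indices with
`Im t_{j_N} ≤ ⋯ ≤ Im t_{j_2} ≤ Im t_{j_1}`. -/
def IsImOrdering {n : ℕ} (t : Fin (n + 1) → ℂ) (j : Equiv.Perm (Fin (n + 1))) : Prop :=
  Antitone fun k => (t (j k)).im

/-- `φ_N(t) = Im (t_{j_1} + t_{j_N}) / 2`. -/
def phi {n : ℕ} (t : Fin (n + 1) → ℂ) (j : Equiv.Perm (Fin (n + 1))) : ℝ :=
  (t (j 0) + t (j (Fin.last n))).im / 2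

/-- `d_N(t) = Im (t_{j_1} - t_{j_N})`. -/
def dist {n : ℕ} (t : Fin (n + 1) → ℂ) (j : Equiv.Perm (Fin (n + 1))) : ℝ :=
  (t (j 0) - t (j (Fin.last n))).im

/-- The function `x / sinh (a x)`, with its continuous value `1 / a` at `x = 0`. -/
def sinhRatio (a x : ℝ) : ℝ :=
  if x = 0 then 1 / a else x / Real.sinh (a * x)

end

end CalogeroMoser

/-! By induction on `N`, one proves the bound at real points together with holomorphy. On the tube
`|Im t_j| < π / 2` the kernel `∏ [2 cosh (t_j - s_k)]^{-lam}` is holomorphic in `t` and its modulus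
is at most a constant times `exp (-Re lam * ∑ |Re t_j - s_k|)`, so by the induction hypothesis the
integrand is dominated by a multiple of
`∏_{k<l} |s_k - s_l| * exp (Re lam * (∑_{k<l} |s_k - s_l| - ∑_{j,k} |Re t_j - s_k|))`. The
interlacing inequality, for decreasing `x = Re t` and `s`,
`∑_{j,k} |x_j - s_k| ≥ ∑_{k<l} |s_k - s_l| + ∑_{k<l} |x_k - x_l| + 2 ∑_k dist (s_k, [x_{k+1}, x_k])`
leaves exponential decay in the distance of `s_k` from `[x_{k+1}, x_k]`; integrating over `s` gives
a multiple of `∏_{k<l} (1 + |x_k - x_l|) exp (-Re lam * |x_k - x_l|)`, which is comparable with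
`∏_{k<l} (x_k - x_l) / sinh (Re lam * (x_k - x_l))`. Finally, the covariance
`F (t_1 + c, …, t_N + c) = exp (i c ∑ u_j) F (t)` extends from real to complex `c` and carries `F`
over to the tubes `|Im t_j - c| < π / 2`, which cover `𝒜_N`. For a point `t` in `𝒜_N` the tube with
axis `φ_N(t)` gives the bound. -/

namespace CalogeroMoser

open Finset MeasureTheory Real
open scoped Nat

noncomputable section

/-! ### Sums and products over pairs -/

@[to_additive]
theorem prod_Ioi_comp_perm {M : Type*} [CommMonoid M] {m : ℕ} {f : Fin m → Fin m → M}
    (hf : ∀ k l, f k l = f l k) (σ : Equiv.Perm (Fin m)) :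
    ∏ k, ∏ l ∈ Ioi k, f (σ k) (σ l) = ∏ k, ∏ l ∈ Ioi k, f k l := by
  have sigma (g : Fin m → Fin m → M) :
      ∏ k, ∏ l ∈ Ioi k, g k l = ∏ x ∈ Equiv.Perm.finPairsLT m, g x.2 x.1 := by
    rw [prod_comm' (t' := univ) (s' := Iio) (by simp), prod_sigma']
    exact prod_congr (by ext; simp [Equiv.Perm.mem_finPairsLT]) fun _ _ => rfl
  rw [sigma, sigma]
  refine prod_nbij (Equiv.Perm.signBijAux σ) Equiv.Perm.signBijAux_mem
    Equiv.Perm.signBijAux_injOn Equiv.Perm.signBijAux_surj fun x _ => ?_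
  unfold Equiv.Perm.signBijAux
  split_ifs
  · rfl
  · exact hf _ _

theorem prod_Ioi_eq_prod_Ici_castSucc_succ {M : Type*} [CommMonoid M] {m : ℕ}
    (f : Fin (m + 1) → Fin (m + 1) → M) :
    ∏ k, ∏ l ∈ Ioi k, f k l = ∏ k : Fin m, ∏ l ∈ Ici k, f k.castSucc l.succ := by
  have Ioi_castSucc (k : Fin m) : Ioi k.castSucc = (Ici k).map (Fin.succEmb m) := by
    rw [Fin.map_succEmb_Ici]
    ext l
    simp [Fin.castSucc_lt_iff_succ_le]
  rw [Fin.prod_univ_castSucc, ← Fin.top_eq_last, Ioi_top, prod_empty, mul_one]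
  simp_rw [Ioi_castSucc, prod_map, Fin.coe_succEmb]

theorem prod_Ioi_const {M : Type*} [CommMonoid M] (m : ℕ) (c : M) :
    ∏ k : Fin m, ∏ _l ∈ Ioi k, c = c ^ m.choose 2 := by
  have card_pairs : ∑ k : Fin m, (m - 1 - k) = m.choose 2 := by
    rw [Fin.sum_univ_eq_sum_range (fun k => m - 1 - k), sum_range_reflect (fun k => k),
      sum_range_id, Nat.choose_two_right]
  simp_rw [prod_const, Fin.card_Ioi]
  rw [prod_pow_eq_pow_sum, card_pairs]

/-- The product `∏_{k < l} f (x_k - x_l)`. -/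
def pairProd (f : ℝ → ℝ) {m : ℕ} (x : Fin m → ℝ) : ℝ :=
  ∏ k, ∏ l ∈ Ioi k, f (x k - x l)

/-- The sum `∑_{k < l} |x_k - x_l|` of the mutual distances of the points `x_k`. -/
def pairDist {m : ℕ} (x : Fin m → ℝ) : ℝ :=
  ∑ k, ∑ l ∈ Ioi k, |x k - x l|

/-- The sum `∑_{j, k} |t_j - s_k|` of the distances between the points `t_j` and the points
`s_k`. -/
def crossDist {n m : ℕ} (t : Fin n → ℝ) (s : Fin m → ℝ) : ℝ :=
  ∑ j, ∑ k, |t j - s k|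

section PairProd

variable {m : ℕ} {f g : ℝ → ℝ} (x : Fin m → ℝ)

theorem pairProd_comp_perm (hf : Function.Even f) (σ : Equiv.Perm (Fin m)) :
    pairProd f (x ∘ σ) = pairProd f x :=
  prod_Ioi_comp_perm (f := fun k l => f (x k - x l)) (fun k l => by rw [← hf, neg_sub]) σ

theorem pairDist_comp_perm (σ : Equiv.Perm (Fin m)) : pairDist (x ∘ σ) = pairDist x :=
  sum_Ioi_comp_perm (f := fun k l => |x k - x l|) (fun _ _ => abs_sub_comm _ _) σ

theorem pairProd_mul : pairProd (fun y => f y * g y) x = pairProd f x * pairProd g x := by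
  simp only [pairProd, prod_mul_distrib]

theorem pairProd_const_mul (c : ℝ) :
    pairProd (fun y => c * f y) x = c ^ m.choose 2 * pairProd f x := by
  simp only [pairProd, prod_mul_distrib, prod_Ioi_const]

theorem pairProd_exp_abs (a : ℝ) :
    pairProd (fun y => exp (a * |y|)) x = exp (a * pairDist x) := by
  simp only [pairProd, pairDist, mul_sum, exp_sum]

variable {x}

theorem pairProd_nonneg (hf : ∀ y, 0 ≤ f y) : 0 ≤ pairProd f x :=
  prod_nonneg fun _ _ => prod_nonneg fun _ _ => hf _

theorem pairProd_pos (hf : ∀ y, 0 < f y) : 0 < pairProd f x :=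
  prod_pos fun _ _ => prod_pos fun _ _ => hf _

theorem pairProd_mono (hf : ∀ y, 0 ≤ f y) (hfg : ∀ y, f y ≤ g y) :
    pairProd f x ≤ pairProd g x :=
  prod_le_prod (fun _ _ => prod_nonneg fun _ _ => hf _) fun _ _ =>
    prod_le_prod (fun _ _ => hf _) fun _ _ => hfg _

end PairProd

section CrossDist

variable {n m : ℕ} (t : Fin n → ℝ) (s : Fin m → ℝ)

theorem crossDist_comp_perm_left (σ : Equiv.Perm (Fin n)) :
    crossDist (t ∘ σ) s = crossDist t s :=
  Equiv.sum_comp σ fun j => ∑ k, |t j - s k|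

theorem crossDist_comp_perm_right (σ : Equiv.Perm (Fin m)) :
    crossDist t (s ∘ σ) = crossDist t s :=
  sum_congr rfl fun j _ => Equiv.sum_comp σ fun k => |t j - s k|

theorem crossDist_le_add (t' : Fin n → ℝ) :
    crossDist t s ≤ m * ∑ j, |t j - t' j| + crossDist t' s := by
  calc crossDist t s ≤ ∑ j, ∑ k, (|t j - t' j| + |t' j - s k|) :=
        sum_le_sum fun _ _ => sum_le_sum fun _ _ => abs_sub_le _ _ _
    _ = m * ∑ j, |t j - t' j| + crossDist t' s := by
        simp only [crossDist, sum_add_distrib, sum_const, card_univ, Fintype.card_fin,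
          nsmul_eq_mul, mul_sum]

end CrossDist

/-! ### The interlacing inequality -/

/-- For points `t_0, …, t_m` and `s_0, …, s_{m-1}` this is an identity between signed distances:
in each difference the sign is the one that makes it nonnegative when `t` and `s` interlace. -/
theorem sum_sub_add_sum_sub_eq {R : Type*} [CommRing R] {m : ℕ} (t : Fin (m + 1) → R)
    (s : Fin m → R) :
    (∑ k, ∑ l ∈ Ioi k, (s k - s l)) + ∑ k, ∑ l ∈ Ioi k, (t k - t l) =
      ∑ j, ∑ k : Fin m, if j ≤ k.castSucc then t j - s k else s k - t j := by
  induction m with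
  | zero => simp
  | succ m ih =>
    have tail (j : Fin (m + 1)) :
        (∑ k : Fin (m + 1), if j.succ ≤ k.castSucc then t j.succ - s k else s k - t j.succ) =
          (s 0 - t j.succ) + ∑ k : Fin m,
            if j ≤ k.castSucc then t j.succ - s k.succ else s k.succ - t j.succ := by
      rw [Fin.sum_univ_succ]
      simp [Fin.castSucc_succ]
    rw [Fin.sum_univ_succ (fun k : Fin (m + 1) => ∑ l ∈ Ioi k, (s k - s l)),
      Fin.sum_univ_succ (fun k : Fin (m + 2) => ∑ l ∈ Ioi k, (t k - t l)),
      Fin.sum_univ_succ (fun j : Fin (m + 2) => ∑ k : Fin (m + 1), ite _ _ _)]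
    simp_rw [Fin.sum_Ioi_zero, Fin.sum_Ioi_succ, Fin.zero_le, if_true, tail]
    rw [sum_add_distrib, ← ih, Fin.sum_univ_succ (fun k : Fin (m + 1) => t 0 - s k)]
    simp only [sum_sub_distrib, sum_const, card_univ, Fintype.card_fin, nsmul_eq_mul]
    push_cast
    ring

/-- The distance from `x` to the interval `[b, a]`, when `b ≤ a`. -/
def gapDist (a b x : ℝ) : ℝ := max 0 (x - a) + max 0 (b - x)

theorem gapDist_nonneg (a b x : ℝ) : 0 ≤ gapDist a b x :=
  add_nonneg (le_max_left _ _) (le_max_left _ _)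

theorem sub_le_gapDist_left (a b x : ℝ) : x - a ≤ gapDist a b x :=
  (le_max_right _ _).trans (le_add_of_nonneg_right (le_max_left _ _))

theorem sub_le_gapDist_right (a b x : ℝ) : b - x ≤ gapDist a b x :=
  (le_max_right _ _).trans (le_add_of_nonneg_left (le_max_left _ _))

theorem two_mul_gapDist_le_sum {m : ℕ} (t : Fin (m + 1) → ℝ) (k : Fin m) (x : ℝ) :
    2 * gapDist (t k.castSucc) (t k.succ) x ≤
      ∑ j, (|t j - x| - if j ≤ k.castSucc then t j - x else x - t j) := by
  have abs_sub_self (y : ℝ) : |y| - y = 2 * max 0 (-y) := by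
    rcases le_total 0 y with hy | hy
    · rw [abs_of_nonneg hy, max_eq_left (by linarith), sub_self, mul_zero]
    · rw [abs_of_nonpos hy, max_eq_right (by linarith)]
      ring
  have excess_nonneg (j : Fin (m + 1)) :
      0 ≤ |t j - x| - if j ≤ k.castSucc then t j - x else x - t j := by
    split_ifs
    · exact sub_nonneg.2 (le_abs_self _)
    · exact sub_nonneg.2 (abs_sub_comm x (t j) ▸ le_abs_self _)
  refine Eq.trans_le ?_ (sum_le_sum_of_subset_of_nonneg (subset_univ {k.castSucc, k.succ})
    fun j _ _ => excess_nonneg j)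
  rw [sum_pair k.castSucc_lt_succ.ne, if_pos le_rfl, if_neg (not_le.2 k.castSucc_lt_succ),
    abs_sub_comm (t k.succ), abs_sub_self, abs_sub_self, neg_sub, neg_sub, gapDist, mul_add]

theorem pairDist_eq_sum_sub {m : ℕ} {x : Fin m → ℝ} (hx : Antitone x) :
    pairDist x = ∑ k, ∑ l ∈ Ioi k, (x k - x l) :=
  sum_congr rfl fun _ _ => sum_congr rfl fun _ hl =>
    abs_of_nonneg (sub_nonneg.2 (hx (mem_Ioi.1 hl).le))

theorem pairDist_add_pairDist_add_sum_gapDist_le {m : ℕ} {t : Fin (m + 1) → ℝ} {s : Fin m → ℝ}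
    (ht : Antitone t) (hs : Antitone s) :
    pairDist s + pairDist t + 2 * ∑ k : Fin m, gapDist (t k.castSucc) (t k.succ) (s k) ≤
      crossDist t s := by
  have hgap := sum_le_sum fun k (_ : k ∈ univ) => two_mul_gapDist_le_sum t k (s k)
  rw [sum_comm] at hgap
  simp only [sum_sub_distrib] at hgap
  rw [pairDist_eq_sum_sub hs, pairDist_eq_sum_sub ht, sum_sub_add_sum_sub_eq, mul_sum, crossDist]
  linarith

theorem abs_sub_le_abs_sub_add_sum_gapDist {m : ℕ} {t : Fin (m + 1) → ℝ} {s : Fin m → ℝ}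
    (ht : Antitone t) (hs : Antitone s) {k l : Fin m} (hkl : k < l) :
    |s k - s l| ≤ |t k.castSucc - t l.succ| +
      ∑ i : Fin m, gapDist (t i.castSucc) (t i.succ) (s i) := by
  have hsum : gapDist (t k.castSucc) (t k.succ) (s k) + gapDist (t l.castSucc) (t l.succ) (s l) ≤
      ∑ i : Fin m, gapDist (t i.castSucc) (t i.succ) (s i) := by
    rw [← sum_pair (f := fun i : Fin m => gapDist (t i.castSucc) (t i.succ) (s i)) hkl.ne]
    exact sum_le_sum_of_subset_of_nonneg (subset_univ _) fun _ _ _ => gapDist_nonneg _ _ _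
  have hcs : k.castSucc ≤ l.succ :=
    (Fin.castSucc_le_castSucc_iff.2 hkl.le).trans l.castSucc_lt_succ.le
  rw [abs_of_nonneg (sub_nonneg.2 (hs hkl.le)), abs_of_nonneg (sub_nonneg.2 (ht hcs))]
  linarith [sub_le_gapDist_left (t k.castSucc) (t k.succ) (s k),
    sub_le_gapDist_right (t l.castSucc) (t l.succ) (s l)]

/-! ### The real majorant of the integrand -/

theorem integral_exp_neg_abs : ∫ x : ℝ, exp (-|x|) = 2 := by
  rw [integral_comp_abs (f := fun x => exp (-x)), integral_exp_neg_Ioi_zero, mul_one]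

theorem integrable_exp_neg_abs : Integrable fun x : ℝ => exp (-|x|) :=
  .of_integral_ne_zero (integral_exp_neg_abs.trans_ne two_ne_zero)

theorem exp_neg_gapDist_le (a b x : ℝ) :
    exp (-gapDist a b x) ≤
      (Set.Icc b a).indicator 1 x + (exp (-|x - a|) + exp (-|x - b|)) := by
  by_cases hx : x ∈ Set.Icc b a
  · rw [Set.indicator_of_mem hx, Pi.one_apply]
    exact le_add_of_le_of_nonneg (exp_le_one_iff.2 (neg_nonpos.2 (gapDist_nonneg a b x)))
      (by positivity)
  · rw [Set.indicator_of_notMem hx, zero_add]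
    rw [Set.mem_Icc, not_and_or, not_le, not_le] at hx
    rcases hx with hx | hx
    · refine le_add_of_nonneg_of_le (exp_pos _).le (exp_le_exp.2 (neg_le_neg ?_))
      rw [abs_of_neg (sub_neg.2 hx), neg_sub]
      exact sub_le_gapDist_right a b x
    · refine le_add_of_le_of_nonneg (exp_le_exp.2 (neg_le_neg ?_)) (exp_pos _).le
      rw [abs_of_pos (sub_pos.2 hx)]
      exact sub_le_gapDist_left a b x

theorem integrable_indicator_Icc_one (a b : ℝ) :
    Integrable ((Set.Icc b a).indicator (1 : ℝ → ℝ)) :=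
  (integrable_indicator_iff measurableSet_Icc).2 (integrableOn_const (by simp))

theorem integrable_exp_neg_abs_sub_add (a b : ℝ) :
    Integrable fun x => exp (-|x - a|) + exp (-|x - b|) :=
  (integrable_exp_neg_abs.comp_sub_right a).add (integrable_exp_neg_abs.comp_sub_right b)

theorem integrable_exp_neg_gapDist (a b : ℝ) : Integrable fun x => exp (-gapDist a b x) := by
  refine ((integrable_indicator_Icc_one a b).add (integrable_exp_neg_abs_sub_add a b)).mono'
    (Continuous.aestronglyMeasurable (by unfold gapDist; fun_prop)) (ae_of_all _ fun x => ?_)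
  rw [norm_of_nonneg (exp_pos _).le]
  exact exp_neg_gapDist_le a b x

theorem integral_exp_neg_gapDist_le {a b : ℝ} (h : b ≤ a) :
    ∫ x, exp (-gapDist a b x) ≤ 4 * (1 + |a - b|) := by
  calc ∫ x, exp (-gapDist a b x)
      ≤ ∫ x, ((Set.Icc b a).indicator 1 x + (exp (-|x - a|) + exp (-|x - b|))) :=
        integral_mono (integrable_exp_neg_gapDist a b)
          ((integrable_indicator_Icc_one a b).add (integrable_exp_neg_abs_sub_add a b))
          (exp_neg_gapDist_le a b)
    _ = (a - b) + (2 + 2) := by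
        rw [integral_add (integrable_indicator_Icc_one a b) (integrable_exp_neg_abs_sub_add a b),
          integral_add (integrable_exp_neg_abs.comp_sub_right a)
            (integrable_exp_neg_abs.comp_sub_right b),
          integral_sub_right_eq_self (fun x => exp (-|x|)),
          integral_sub_right_eq_self (fun x => exp (-|x|)), integral_exp_neg_abs,
          integral_indicator_one measurableSet_Icc, volume_real_Icc_of_le h]
    _ ≤ 4 * (1 + |a - b|) := by
        rw [abs_of_nonneg (sub_nonneg.2 h)]
        linarith

theorem exists_perm_antitone {α : Type*} [LinearOrder α] {m : ℕ} (x : Fin m → α) :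
    ∃ σ : Equiv.Perm (Fin m), Antitone (x ∘ σ) :=
  ⟨Tuple.sort (OrderDual.toDual ∘ x), Tuple.monotone_sort (OrderDual.toDual ∘ x)⟩

section SymmetricFunction

variable {m : ℕ} {g : (Fin m → ℝ) → ℝ} {f : Fin m → ℝ → ℝ} {K : ℝ}

theorem le_sum_perm_of_antitone_le (hg : ∀ s (σ : Equiv.Perm (Fin m)), g (s ∘ σ) = g s)
    (hK : 0 ≤ K) (hf : ∀ k x, 0 ≤ f k x) (h : ∀ s, Antitone s → g s ≤ K * ∏ k, f k (s k))
    (s : Fin m → ℝ) : g s ≤ ∑ σ : Equiv.Perm (Fin m), K * ∏ k, f (σ k) (s k) := by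
  obtain ⟨σ, hσ⟩ := exists_perm_antitone s
  calc g s = g (s ∘ σ) := (hg s σ).symm
    _ ≤ K * ∏ k, f k (s (σ k)) := h _ hσ
    _ = K * ∏ k, f (σ.symm k) (s k) := by
        rw [← Equiv.prod_comp σ fun k => f (σ.symm k) (s k)]
        simp only [Equiv.symm_apply_apply]
    _ ≤ ∑ σ : Equiv.Perm (Fin m), K * ∏ k, f (σ k) (s k) :=
        single_le_sum (f := fun σ : Equiv.Perm (Fin m) => K * ∏ k, f (σ k) (s k))
          (fun σ _ => mul_nonneg hK (prod_nonneg fun _ _ => hf _ _)) (mem_univ σ.symm)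

theorem integrable_const_mul_prod_perm (hf : ∀ k, Integrable (f k)) (σ : Equiv.Perm (Fin m)) :
    Integrable fun s : Fin m → ℝ => K * ∏ k, f (σ k) (s k) :=
  (Integrable.fintype_prod fun _ => hf _).const_mul K

theorem integrable_of_antitone_le (hmeas : AEStronglyMeasurable g) (hg0 : ∀ s, 0 ≤ g s)
    (hg : ∀ s (σ : Equiv.Perm (Fin m)), g (s ∘ σ) = g s) (hK : 0 ≤ K) (hf0 : ∀ k x, 0 ≤ f k x)
    (hf : ∀ k, Integrable (f k)) (h : ∀ s, Antitone s → g s ≤ K * ∏ k, f k (s k)) :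
    Integrable g := by
  refine (integrable_finsetSum univ fun σ _ => integrable_const_mul_prod_perm (K := K) hf σ).mono'
    hmeas (ae_of_all _ fun s => ?_)
  rw [norm_of_nonneg (hg0 s)]
  exact le_sum_perm_of_antitone_le hg hK hf0 h s

theorem integral_le_of_antitone_le (hmeas : AEStronglyMeasurable g) (hg0 : ∀ s, 0 ≤ g s)
    (hg : ∀ s (σ : Equiv.Perm (Fin m)), g (s ∘ σ) = g s) (hK : 0 ≤ K) (hf0 : ∀ k x, 0 ≤ f k x)
    (hf : ∀ k, Integrable (f k)) (h : ∀ s, Antitone s → g s ≤ K * ∏ k, f k (s k)) :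
    ∫ s, g s ≤ m ! * (K * ∏ k, ∫ x, f k x) := by
  have hint (σ : Equiv.Perm (Fin m)) := integrable_const_mul_prod_perm (K := K) hf σ
  calc ∫ s, g s ≤ ∫ s : Fin m → ℝ, ∑ σ : Equiv.Perm (Fin m), K * ∏ k, f (σ k) (s k) :=
        integral_mono (integrable_of_antitone_le hmeas hg0 hg hK hf0 hf h)
          (integrable_finsetSum univ fun σ _ => hint σ)
          (le_sum_perm_of_antitone_le hg hK hf0 h)
    _ = ∑ σ : Equiv.Perm (Fin m), K * ∏ k, ∫ x, f (σ k) x := by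
        rw [integral_finsetSum univ fun σ _ => hint σ]
        simp_rw [integral_const_mul, integral_fintype_prod_volume_eq_prod]
    _ = m ! * (K * ∏ k, ∫ x, f k x) := by
        simp_rw [Equiv.prod_comp _ fun k => ∫ x, f k x]
        rw [sum_const, card_univ, Fintype.card_perm, Fintype.card_fin, nsmul_eq_mul]

end SymmetricFunction

/-- The real function that dominates the integrand of the recursion, with `a = Re lam`. -/
def integrandMajorant (a : ℝ) {n m : ℕ} (t : Fin n → ℝ) (s : Fin m → ℝ) : ℝ :=
  pairProd (fun y => 2 * |y|) s * exp (a * (pairDist s - crossDist t s))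

/-- The function `(1 + |x|) e^{-a |x|}`, which is comparable with `x / sinh (a x)`. -/
def pairDecay (a x : ℝ) : ℝ := (1 + |x|) * exp (-(a * |x|))

theorem pairDecay_pos (a x : ℝ) : 0 < pairDecay a x := by
  unfold pairDecay
  positivity

theorem even_pairDecay (a : ℝ) : Function.Even (pairDecay a) := fun x => by
  simp only [pairDecay, abs_neg]

section IntegrandMajorant

variable (a : ℝ) {n m : ℕ}

theorem integrandMajorant_nonneg (t : Fin n → ℝ) (s : Fin m → ℝ) :
    0 ≤ integrandMajorant a t s :=
  mul_nonneg (pairProd_nonneg fun _ => by positivity) (exp_pos _).le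

theorem continuous_integrandMajorant (t : Fin n → ℝ) :
    Continuous fun s : Fin m → ℝ => integrandMajorant a t s := by
  unfold integrandMajorant pairProd pairDist crossDist
  fun_prop

theorem integrandMajorant_comp_perm_left (t : Fin n → ℝ) (s : Fin m → ℝ)
    (σ : Equiv.Perm (Fin n)) : integrandMajorant a (t ∘ σ) s = integrandMajorant a t s := by
  rw [integrandMajorant, crossDist_comp_perm_left, integrandMajorant]

theorem integrandMajorant_comp_perm_right (t : Fin n → ℝ) (s : Fin m → ℝ)
    (σ : Equiv.Perm (Fin m)) : integrandMajorant a t (s ∘ σ) = integrandMajorant a t s := by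
  rw [integrandMajorant, crossDist_comp_perm_right, pairDist_comp_perm,
    pairProd_comp_perm _ (fun _ => by simp only [abs_neg]), integrandMajorant]

theorem integrandMajorant_le_exp_mul {a : ℝ} (ha : 0 ≤ a) (t t' : Fin n → ℝ) (s : Fin m → ℝ) :
    integrandMajorant a t s ≤
      exp (a * (m * ∑ j, |t j - t' j|)) * integrandMajorant a t' s := by
  have hdist : crossDist t' s ≤ m * ∑ j, |t j - t' j| + crossDist t s := by
    simpa only [abs_sub_comm] using crossDist_le_add t' s t
  rw [integrandMajorant, integrandMajorant, mul_left_comm, ← exp_add, ← mul_add]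
  gcongr
  · exact pairProd_nonneg fun _ => by positivity
  · linarith

theorem one_add_pow_le_exp (M : ℕ) {x : ℝ} (hx : 0 ≤ x) : (1 + x) ^ M ≤ M ! * exp 1 * exp x := by
  have h := pow_div_factorial_le_exp (1 + x) (by linarith) M
  rwa [div_le_iff₀' (by positivity), exp_add, ← mul_assoc] at h

theorem pairProd_two_mul_abs_le {t : Fin (m + 1) → ℝ} {s : Fin m → ℝ} (ht : Antitone t)
    (hs : Antitone s) :
    pairProd (fun y => 2 * |y|) s ≤
      2 ^ m.choose 2 * ((m.choose 2)! * exp 1 *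
        exp (∑ k : Fin m, gapDist (t k.castSucc) (t k.succ) (s k))) *
        ∏ k : Fin m, ∏ l ∈ Ioi k, (1 + |t k.castSucc - t l.succ|) := by
  have hdist (k l : Fin m) (hl : l ∈ Ioi k) :=
    abs_sub_le_abs_sub_add_sum_gapDist ht hs (mem_Ioi.1 hl)
  generalize hΔ : ∑ k : Fin m, gapDist (t k.castSucc) (t k.succ) (s k) = Δ at hdist ⊢
  have hΔ0 : 0 ≤ Δ := hΔ ▸ sum_nonneg fun _ _ => gapDist_nonneg _ _ _
  calc pairProd (fun y => 2 * |y|) s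
      ≤ ∏ k : Fin m, ∏ l ∈ Ioi k, 2 * (1 + Δ) * (1 + |t k.castSucc - t l.succ|) := by
        refine prod_le_prod (fun _ _ => prod_nonneg fun _ _ => by positivity) fun k _ =>
          prod_le_prod (fun _ _ => by positivity) fun l hl => ?_
        nlinarith [hdist k l hl, abs_nonneg (t k.castSucc - t l.succ)]
    _ = 2 ^ m.choose 2 * (1 + Δ) ^ m.choose 2 *
          ∏ k : Fin m, ∏ l ∈ Ioi k, (1 + |t k.castSucc - t l.succ|) := by
        simp_rw [prod_mul_distrib, prod_Ioi_const]
    _ ≤ _ := by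
        gcongr
        exact one_add_pow_le_exp (m.choose 2) hΔ0

theorem integrandMajorant_le_of_antitone {a : ℝ} (ha : 1 ≤ a) {t : Fin (m + 1) → ℝ}
    {s : Fin m → ℝ} (ht : Antitone t) (hs : Antitone s) :
    integrandMajorant a t s ≤
      2 ^ m.choose 2 * ((m.choose 2)! * exp 1) *
        (∏ k : Fin m, ∏ l ∈ Ioi k, (1 + |t k.castSucc - t l.succ|)) * exp (-(a * pairDist t)) *
        ∏ k : Fin m, exp (-gapDist (t k.castSucc) (t k.succ) (s k)) := by
  have hpoly := pairProd_two_mul_abs_le ht hs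
  have hinter := pairDist_add_pairDist_add_sum_gapDist_le ht hs
  rw [← exp_sum, sum_neg_distrib, integrandMajorant]
  generalize hΔ : ∑ k : Fin m, gapDist (t k.castSucc) (t k.succ) (s k) = Δ at hpoly hinter ⊢
  have hΔ0 : 0 ≤ Δ := hΔ ▸ sum_nonneg fun _ _ => gapDist_nonneg _ _ _
  -- One of the two factors `exp (-Δ)` absorbs the growth of the product of the `2 |s_k - s_l|`.
  have hexp : exp (a * (pairDist s - crossDist t s)) ≤ exp (-(a * pairDist t) - Δ - Δ) := by
    rw [exp_le_exp]
    nlinarith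
  refine (mul_le_mul hpoly hexp (exp_pos _).le
    ((pairProd_nonneg fun _ => by positivity).trans hpoly)).trans_eq ?_
  rw [exp_sub, exp_sub, exp_neg Δ]
  field_simp

theorem prod_mul_prod_mul_exp_eq_pairProd_pairDecay (t : Fin (m + 1) → ℝ) :
    (∏ k : Fin m, ∏ l ∈ Ioi k, (1 + |t k.castSucc - t l.succ|)) *
        (∏ k : Fin m, (1 + |t k.castSucc - t k.succ|)) * exp (-(a * pairDist t)) =
      pairProd (pairDecay a) t := by
  unfold pairDecay
  simp_rw [← neg_mul]
  rw [pairProd_mul, pairProd_exp_abs, ← prod_mul_distrib, pairProd,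
    prod_Ioi_eq_prod_Ici_castSucc_succ]
  exact congrArg (· * _) (prod_congr rfl fun k _ =>
    prod_Ioi_mul_eq_prod_Ici (f := fun l : Fin m => 1 + |t k.castSucc - t l.succ|) k)

end IntegrandMajorant

/-- The constant in the bound for the integral of `integrandMajorant` over `ℝ^m`. -/
def integralConst (m : ℕ) : ℝ :=
  m ! * (2 ^ m.choose 2 * ((m.choose 2)! * exp 1) * 4 ^ m)

theorem integralConst_pos (m : ℕ) : 0 < integralConst m := by
  unfold integralConst
  positivity

section IntegralIntegrandMajorant

variable {a : ℝ} {m : ℕ}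

theorem integrable_integrandMajorant (ha : 1 ≤ a) (t : Fin (m + 1) → ℝ) :
    Integrable fun s : Fin m → ℝ => integrandMajorant a t s := by
  obtain ⟨τ, hτ⟩ := exists_perm_antitone t
  simp_rw [← integrandMajorant_comp_perm_left a t _ τ]
  exact integrable_of_antitone_le (continuous_integrandMajorant a _).aestronglyMeasurable
    (integrandMajorant_nonneg a _) (integrandMajorant_comp_perm_right a _) (by positivity)
    (fun _ _ => (exp_pos _).le) (fun _ => integrable_exp_neg_gapDist _ _)
    fun _ => integrandMajorant_le_of_antitone ha hτ

theorem integral_integrandMajorant_le (ha : 1 ≤ a) (t : Fin (m + 1) → ℝ) :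
    ∫ s : Fin m → ℝ, integrandMajorant a t s ≤ integralConst m * pairProd (pairDecay a) t := by
  wlog ht : Antitone t generalizing t
  · obtain ⟨τ, hτ⟩ := exists_perm_antitone t
    simpa only [integrandMajorant_comp_perm_left, pairProd_comp_perm t (even_pairDecay a)]
      using this (t ∘ τ) hτ
  refine (integral_le_of_antitone_le (continuous_integrandMajorant a t).aestronglyMeasurable
    (integrandMajorant_nonneg a t) (integrandMajorant_comp_perm_right a t) (by positivity)
    (fun _ _ => (exp_pos _).le) (fun _ => integrable_exp_neg_gapDist _ _)
    fun _ => integrandMajorant_le_of_antitone ha ht).trans ?_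
  have hprod : ∏ k : Fin m, ∫ x, exp (-gapDist (t k.castSucc) (t k.succ) x) ≤
      4 ^ m * ∏ k : Fin m, (1 + |t k.castSucc - t k.succ|) := by
    refine (prod_le_prod (fun _ _ => integral_nonneg fun _ => (exp_pos _).le) fun k _ =>
      integral_exp_neg_gapDist_le (ht k.castSucc_lt_succ.le)).trans_eq ?_
    rw [prod_mul_distrib, prod_const, card_univ, Fintype.card_fin]
  refine (mul_le_mul_of_nonneg_left (mul_le_mul_of_nonneg_left hprod (by positivity))
    (by positivity)).trans_eq ?_
  rw [← prod_mul_prod_mul_exp_eq_pairProd_pairDecay, integralConst]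
  ring

end IntegralIntegrandMajorant

/-! ### Comparison of hyperbolic functions with exponentials -/

theorem even_sinhRatio (a : ℝ) : Function.Even (sinhRatio a) := fun x => by
  simp [sinhRatio, neg_div_neg_eq]

theorem sinhRatio_pos {a : ℝ} (ha : 0 < a) (x : ℝ) : 0 < sinhRatio a x := by
  wlog hx : 0 ≤ x generalizing x
  · rw [← even_sinhRatio]
    exact this _ (by linarith)
  unfold sinhRatio
  split_ifs with h
  · positivity
  · have hx' : 0 < x := lt_of_le_of_ne hx (Ne.symm h)
    exact div_pos hx' (sinh_pos_iff.2 (mul_pos ha hx'))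

theorem exp_neg_mul_sinh (y : ℝ) : exp (-y) * sinh y = (1 - exp (-(2 * y))) / 2 := by
  rw [sinh_eq, mul_div_assoc', mul_sub, ← exp_add, ← exp_add, neg_add_cancel, exp_zero]
  ring_nf

theorem pairDecay_le_sinhRatio {a : ℝ} (ha : 0 < a) (x : ℝ) :
    pairDecay a x ≤ (a + 1) * sinhRatio a x := by
  wlog hx : 0 ≤ x generalizing x
  · rw [← even_sinhRatio, ← even_pairDecay]
    exact this _ (by linarith)
  rw [pairDecay, abs_of_nonneg hx, sinhRatio]
  split_ifs with h
  · subst h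
    field_simp
    simp
  have hax : 0 < a * x := mul_pos ha (lt_of_le_of_ne hx (Ne.symm h))
  rw [mul_div_assoc', le_div_iff₀ (sinh_pos_iff.2 hax), mul_assoc, exp_neg_mul_sinh]
  have le_half : (1 - exp (-(2 * (a * x)))) / 2 ≤ 1 / 2 := by linarith [exp_pos (-(2 * (a * x)))]
  have le_self : (1 - exp (-(2 * (a * x)))) / 2 ≤ a * x := by
    linarith [add_one_le_exp (-(2 * (a * x)))]
  nlinarith

theorem two_mul_sinh_rpow_le {a x : ℝ} (ha : 1 ≤ a) (hx : 0 ≤ x) :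
    (2 * sinh x) ^ a ≤ 2 * sinh (a * x) := by
  have hsinh : 0 ≤ 2 * sinh x := mul_nonneg zero_le_two (sinh_nonneg_iff.2 hx)
  have superadditive : (2 * sinh x) ^ a + exp (-x) ^ a ≤ (2 * sinh x + exp (-x)) ^ a :=
    mod_cast NNReal.add_rpow_le_rpow_add ⟨2 * sinh x, hsinh⟩ ⟨exp (-x), (exp_pos _).le⟩ ha
  have hexp : 2 * sinh x + exp (-x) = exp x := by rw [sinh_eq]; ring
  rw [hexp, ← exp_mul, ← exp_mul, neg_mul, mul_comm x] at superadditive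
  rw [sinh_eq (a * x)]
  linarith

theorem even_four_mul_sinh_sq_rpow_mul_sinhRatio (a : ℝ) :
    Function.Even fun x => (4 * sinh x ^ 2) ^ a * sinhRatio a x := fun x => by
  simp only [sinh_neg, neg_sq, even_sinhRatio a x]

theorem four_mul_sinh_sq_rpow_mul_sinhRatio_le {a : ℝ} (ha : 1 ≤ a) (x : ℝ) :
    (4 * sinh x ^ 2) ^ a * sinhRatio a x ≤ 2 * |x| * exp (a * |x|) := by
  wlog hx : 0 ≤ x generalizing x
  · rw [← abs_neg]
    exact (even_four_mul_sinh_sq_rpow_mul_sinhRatio a x).ge.trans (this _ (by linarith))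
  have ha0 : 0 < a := by linarith
  obtain rfl | hx' := hx.eq_or_lt
  · simp [zero_rpow ha0.ne']
  have : 0 < sinh x := sinh_pos_iff.2 hx'
  have hsinh' : 0 < sinh (a * x) := sinh_pos_iff.2 (mul_pos ha0 hx')
  have hsq : (4 * sinh x ^ 2) ^ a = (2 * sinh x) ^ a * (2 * sinh x) ^ a := by
    rw [← mul_rpow (by positivity) (by positivity)]
    ring_nf
  have hexp : (2 * sinh x) ^ a ≤ exp (a * x) := by
    rw [mul_comm a, exp_mul]
    refine rpow_le_rpow (by positivity) ?_ ha0.le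
    rw [sinh_eq]
    linarith [exp_pos (-x)]
  rw [hsq, abs_of_pos hx', sinhRatio, if_neg hx'.ne', mul_div_assoc', div_le_iff₀ hsinh']
  calc (2 * sinh x) ^ a * (2 * sinh x) ^ a * x
      ≤ exp (a * x) * (2 * sinh (a * x)) * x := by
        gcongr
        exact two_mul_sinh_rpow_le ha hx
    _ = _ := by ring

/-! ### Holomorphic functions of several variables -/

theorem eqOn_of_eq_ofReal {U : Set ℂ} (hU : IsOpen U) (hconv : Convex ℝ U)
    (hreal : ∀ x : ℝ, (x : ℂ) ∈ U) {f g : ℂ → ℂ} (hf : DifferentiableOn ℂ f U)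
    (hg : DifferentiableOn ℂ g U) (h : ∀ x : ℝ, f x = g x) : Set.EqOn f g U := by
  refine (hf.analyticOnNhd hU).eqOn_of_preconnected_of_frequently_eq (hg.analyticOnNhd hU)
    hconv.isPreconnected (hreal 0) ?_
  have ofReal_tendsto : Filter.Tendsto (fun x : ℝ => (x : ℂ)) (nhdsWithin 0 {0}ᶜ)
      (nhdsWithin ((0 : ℝ) : ℂ) {((0 : ℝ) : ℂ)}ᶜ) :=
    Complex.continuous_ofReal.continuousWithinAt.tendsto_nhdsWithin fun x hx => by simpa using hx
  exact ofReal_tendsto.frequently (Filter.Eventually.of_forall h).frequently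

theorem eqOn_pi_of_eq_ofReal {m : ℕ} {U : Set (Fin m → ℂ)} (hU : IsOpen U) (hconv : Convex ℝ U)
    (hreal : ∀ x : Fin m → ℝ, (fun j => (x j : ℂ)) ∈ U) {f g : (Fin m → ℂ) → ℂ}
    (hf : DifferentiableOn ℂ f U) (hg : DifferentiableOn ℂ g U)
    (h : ∀ x : Fin m → ℝ, f (fun j => (x j : ℂ)) = g fun j => (x j : ℂ)) : Set.EqOn f g U := by
  intro t ht
  let re : Fin m → ℂ := fun j => (t j).re
  let im : Fin m → ℂ := fun j => (t j).im
  let line (z : ℂ) : Fin m → ℂ := re + z • im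
  have line_I : line Complex.I = t := by
    ext j
    exact (congrArg _ (mul_comm _ _)).trans (Complex.re_add_im (t j))
  have line_ofReal (x : ℝ) : line x = fun j => (((t j).re + x * (t j).im : ℝ) : ℂ) := by
    ext j
    simp [line, re, im]
  have line_differentiable : Differentiable ℂ line := by fun_prop
  rw [← line_I]
  refine eqOn_of_eq_ofReal (hU.preimage line_differentiable.continuous)
    ((hconv.translate_preimage_right re).linear_preimage
      ((LinearMap.toSpanSingleton ℂ _ im).restrictScalars ℝ)) (fun x => ?_)
    (hf.comp line_differentiable.differentiableOn fun _ => id)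
    (hg.comp line_differentiable.differentiableOn fun _ => id) (fun x => ?_)
    (show line Complex.I ∈ U by rwa [line_I])
  · rw [Set.mem_preimage, line_ofReal]
    exact hreal _
  · simp only [Function.comp_apply, line_ofReal]
    exact h _

section ParametricIntegral

variable {α : Type*} [MeasurableSpace α] {μ : Measure α}

section Measurability

variable {𝕜 E G : Type*} [NontriviallyNormedField 𝕜] [NormedAddCommGroup E] [NormedSpace 𝕜 E]
  [NormedAddCommGroup G] [NormedSpace 𝕜 G]

theorem aestronglyMeasurable_of_forall_apply [CompleteSpace 𝕜] [FiniteDimensional 𝕜 E]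
    {L : α → E →L[𝕜] G} (h : ∀ v, AEStronglyMeasurable (fun s => L s v) μ) :
    AEStronglyMeasurable L μ := by
  let b := Module.finBasis 𝕜 E
  let coord i : E →L[𝕜] 𝕜 := (b.coord i).toContinuousLinearMap
  have sum_coord (s : α) :
      L s = ∑ i, ContinuousLinearMap.smulRightL 𝕜 E G (coord i) (L s (b i)) := by
    ext v
    conv_lhs => rw [← b.sum_repr v, map_sum]
    simp [coord]
  rw [funext sum_coord]
  exact aestronglyMeasurable_fun_sum _ fun i _ =>
    (ContinuousLinearMap.smulRightL 𝕜 E G (coord i)).continuous.comp_aestronglyMeasurable (h (b i))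

theorem aestronglyMeasurable_fderiv_apply {f : E → α → G} {x : E}
    (hmeas : ∀ᶠ t in nhds x, AEStronglyMeasurable (f t) μ)
    (hdiff : ∀ s, DifferentiableAt 𝕜 (fun t => f t s) x) (v : E) :
    AEStronglyMeasurable (fun s => fderiv 𝕜 (fun t => f t s) x v) μ := by
  have tendsto_x : Filter.Tendsto (fun c : 𝕜 => x + c • v) (nhdsWithin 0 {0}ᶜ) (nhds x) :=
    (Continuous.tendsto' (by fun_prop) 0 x (by simp)).mono_left nhdsWithin_le_nhds
  obtain ⟨c, hc, hmeas_c⟩ :=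
    Filter.exists_seq_forall_of_frequently (tendsto_x.eventually hmeas).frequently
  exact aestronglyMeasurable_of_tendsto_ae Filter.atTop
    (fun k => ((hmeas_c k).sub hmeas.self_of_nhds).const_smul (c k)⁻¹)
    (ae_of_all _ fun s => ((hdiff s).hasFDerivAt.hasLineDerivAt v).tendsto_slope_zero.comp hc)

end Measurability

variable {E G : Type*} [NormedAddCommGroup E] [NormedSpace ℂ E] [FiniteDimensional ℂ E]
  [NormedAddCommGroup G] [NormedSpace ℂ G]

theorem differentiableOn_integral_of_locally_dominated {f : E → α → G} {U : Set E} (hU : IsOpen U)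
    (hmeas : ∀ t ∈ U, AEStronglyMeasurable (f t) μ)
    (hdiff : ∀ s, DifferentiableOn ℂ (fun t => f t s) U)
    (hdom : ∀ x ∈ U, ∃ b : α → ℝ, Integrable b μ ∧ ∀ᶠ t in nhds x, ∀ s, ‖f t s‖ ≤ b s) :
    DifferentiableOn ℂ (fun t => ∫ s, f t s ∂μ) U := by
  intro x hx
  obtain ⟨b, hb, hle⟩ := hdom x hx
  obtain ⟨r, hr, hball⟩ := Metric.eventually_nhds_iff_ball.1 (hle.and (hU.eventually_mem hx))
  have hdiffAt (s : α) {t : E} (ht : t ∈ U) : DifferentiableAt ℂ (fun t => f t s) t :=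
    (hdiff s).differentiableAt (hU.mem_nhds ht)
  have hmeas' : ∀ᶠ t in nhds x, AEStronglyMeasurable (f t) μ := (hU.eventually_mem hx).mono hmeas
  have cauchy_estimate : ∀ s, ∀ t ∈ Metric.ball x (r / 2),
      ‖fderiv ℂ (fun t => f t s) t‖ ≤ 2 * b s / (r / 2) := fun s t ht => by
    have hsub : Metric.ball t (r / 2) ⊆ Metric.ball x r :=
      (Metric.ball_subset_ball' (by linarith [Metric.mem_ball.1 ht]))
    refine Complex.norm_fderiv_le_div_of_mapsTo_ball
      ((hdiff s).mono fun y hy => (hball y (hsub hy)).2) (fun y hy => ?_) (half_pos hr)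
    rw [mem_closedBall_iff_norm]
    have hy' := (hball y (hsub hy)).1 s
    have ht' := (hball t (hsub (Metric.mem_ball_self (half_pos hr)))).1 s
    linarith [norm_sub_le (f y s) (f t s)]
  have hasFDerivAt := hasFDerivAt_integral_of_dominated_of_fderiv_le
    (Metric.ball_mem_nhds x (half_pos hr)) hmeas'
    (hb.mono' (hmeas x hx) (ae_of_all _ (hball x (Metric.mem_ball_self hr)).1))
    (aestronglyMeasurable_of_forall_apply
      (aestronglyMeasurable_fderiv_apply hmeas' fun s => hdiffAt s hx))
    (ae_of_all _ cauchy_estimate) ((hb.const_mul 2).div_const _)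
    (ae_of_all _ fun s t ht =>
      (hdiffAt s (hball t (Metric.ball_subset_ball (by linarith) ht)).2).hasFDerivAt)
  exact hasFDerivAt.differentiableAt.differentiableWithinAt

end ParametricIntegral

theorem differentiableOn_finsetProd {𝕜 E A ι : Type*} [NontriviallyNormedField 𝕜]
    [NormedAddCommGroup E] [NormedSpace 𝕜 E] [NormedCommRing A] [NormedAlgebra 𝕜 A]
    {U : Set E} {u : Finset ι} {f : ι → E → A} (h : ∀ i ∈ u, DifferentiableOn 𝕜 (f i) U) :
    DifferentiableOn 𝕜 (fun t => ∏ i ∈ u, f i t) U := by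
  classical
  intro t ht
  have hasFDerivWithinAt := HasFDerivWithinAt.finsetProd
    fun i hi => (h i hi t ht).hasFDerivWithinAt
  exact hasFDerivWithinAt.differentiableWithinAt

/-! ### Powers of the hyperbolic cosine in a strip -/

theorem re_two_mul_cosh (z : ℂ) : (2 * Complex.cosh z).re = 2 * cosh z.re * cos z.im := by
  conv_lhs => rw [← Complex.re_add_im z]
  rw [Complex.cosh_add, Complex.cosh_mul_I, Complex.sinh_mul_I, ← Complex.ofReal_cosh,
    ← Complex.ofReal_sinh, ← Complex.ofReal_cos, ← Complex.ofReal_sin]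
  simp [-Complex.ofReal_cos, -Complex.ofReal_cosh, mul_assoc]

theorem two_mul_cosh_mem_slitPlane {z : ℂ} (hz : |z.im| < π / 2) :
    2 * Complex.cosh z ∈ Complex.slitPlane := by
  refine Or.inl ?_
  have hcos := cos_pos_of_mem_Ioo (abs_lt.1 hz)
  have := cosh_pos z.re
  rw [re_two_mul_cosh]
  positivity

theorem cos_im_mul_exp_abs_re_le_norm_two_mul_cosh {z : ℂ} (hz : 0 ≤ cos z.im) :
    cos z.im * exp |z.re| ≤ ‖2 * Complex.cosh z‖ := by
  have exp_le : exp |z.re| ≤ 2 * cosh z.re := by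
    rw [← cosh_abs, cosh_eq]
    linarith [exp_pos (-|z.re|)]
  calc cos z.im * exp |z.re| ≤ cos z.im * (2 * cosh z.re) := by gcongr
    _ = (2 * Complex.cosh z).re := by rw [re_two_mul_cosh, mul_comm]
    _ ≤ ‖2 * Complex.cosh z‖ := Complex.re_le_norm _

theorem norm_cpow_le_rpow_mul_exp (z w : ℂ) : ‖z ^ w‖ ≤ ‖z‖ ^ w.re * exp (π * |w.im|) := by
  refine (Complex.norm_cpow_le z w).trans ?_
  rw [div_eq_mul_inv, ← exp_neg]
  gcongr
  calc -(z.arg * w.im) ≤ |z.arg * w.im| := neg_le_abs _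
    _ ≤ π * |w.im| := by
      rw [abs_mul]
      gcongr
      exact Complex.abs_arg_le_pi z

/-- The constant that bounds one factor `[2 cosh z]^{-lam}` of the kernel, relative to
`exp (-Re lam * |Re z|)`, in the strip `|Im z| ≤ θ`. -/
def coshConst (lam : ℂ) (θ : ℝ) : ℝ := cos θ ^ (-lam.re) * exp (π * |lam.im|)

theorem coshConst_nonneg (lam : ℂ) {θ : ℝ} (hθ : θ ∈ Set.Ico 0 (π / 2)) : 0 ≤ coshConst lam θ :=
  mul_nonneg (rpow_nonneg (cos_nonneg_of_mem_Icc ⟨by linarith [hθ.1, pi_pos], hθ.2.le⟩) _)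
    (exp_pos _).le

theorem norm_two_mul_cosh_cpow_le {lam : ℂ} (hlam : 0 ≤ lam.re) {θ : ℝ} (hθ : θ < π / 2) {z : ℂ}
    (hz : |z.im| ≤ θ) :
    ‖(2 * Complex.cosh z) ^ (-lam)‖ ≤ coshConst lam θ * exp (-(lam.re * |z.re|)) := by
  have hcosθ : 0 < cos θ := cos_pos_of_mem_Ioo ⟨by linarith [abs_nonneg z.im], hθ⟩
  have hcos : cos θ ≤ cos z.im := by
    rw [← cos_abs z.im]
    exact cos_le_cos_of_nonneg_of_le_pi (abs_nonneg _) (by linarith [pi_pos]) hz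
  have norm_ge : cos θ * exp |z.re| ≤ ‖2 * Complex.cosh z‖ := le_trans (by gcongr)
    (cos_im_mul_exp_abs_re_le_norm_two_mul_cosh (hcosθ.le.trans hcos))
  calc ‖(2 * Complex.cosh z) ^ (-lam)‖
      ≤ ‖2 * Complex.cosh z‖ ^ (-lam.re) * exp (π * |lam.im|) := by
        simpa using norm_cpow_le_rpow_mul_exp (2 * Complex.cosh z) (-lam)
    _ ≤ (cos θ * exp |z.re|) ^ (-lam.re) * exp (π * |lam.im|) := by
        gcongr ?_ * _
        exact rpow_le_rpow_of_nonpos (by positivity) norm_ge (neg_nonpos.2 hlam)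
    _ = coshConst lam θ * exp (-(lam.re * |z.re|)) := by
        rw [mul_rpow hcosθ.le (exp_pos _).le, ← exp_mul, coshConst, mul_neg, mul_comm |z.re|]
        ring

/-! ### Weight and kernel -/

/-- The tube of all `t` whose coordinates have imaginary part at distance less than `π / 2` from
the axis `c`. -/
def tube (m : ℕ) (c : ℝ) : Set (Fin m → ℂ) := {t | ∀ j, |(t j).im - c| < π / 2}

theorem tube_eq_pi (m : ℕ) (c : ℝ) :
    tube m c = Set.univ.pi fun _ => Complex.im ⁻¹' Metric.ball c (π / 2) := by
  ext t
  simp [tube, Real.dist_eq]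

theorem isOpen_tube (m : ℕ) (c : ℝ) : IsOpen (tube m c) := by
  rw [tube_eq_pi]
  exact isOpen_set_pi Set.finite_univ fun _ _ => Metric.isOpen_ball.preimage Complex.continuous_im

theorem convex_tube (m : ℕ) (c : ℝ) : Convex ℝ (tube m c) := by
  rw [tube_eq_pi]
  exact convex_pi fun _ _ => (convex_ball c _).linear_preimage Complex.imLm

theorem mem_tube_iff_sub_mem_tube_zero {m : ℕ} {c : ℝ} {t : Fin m → ℂ} :
    t ∈ tube m c ↔ (fun j => t j - c * Complex.I) ∈ tube m 0 := by
  simp [tube]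

/-- The kernel function `∏_{j ≤ m+1} ∏_{k ≤ m} [2 cosh(t_j - s_k)]^{-lam}` at complex `t`, with the
principal branch of the power. -/
def complexKernel (lam : ℂ) {m : ℕ} (t : Fin (m + 1) → ℂ) (s : Fin m → ℝ) : ℂ :=
  ∏ j, ∏ k, (2 * Complex.cosh (t j - s k)) ^ (-lam)

section WeightKernel

variable {lam : ℂ} {m : ℕ}

theorem complexKernel_ofReal (t : Fin (m + 1) → ℝ) (s : Fin m → ℝ) :
    complexKernel lam (fun j => (t j : ℂ)) s = kernel lam t s := by
  simp [complexKernel, kernel]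

theorem weight_add_const (s : Fin m → ℝ) (c : ℝ) :
    weight lam (fun k => s k + c) = weight lam s := by
  simp [weight]

theorem complexKernel_add_const (t : Fin (m + 1) → ℂ) (s : Fin m → ℝ) (c : ℝ) :
    complexKernel lam (fun j => t j + c) (fun k => s k + c) = complexKernel lam t s := by
  simp [complexKernel]

theorem measurable_weight : Measurable fun s : Fin m → ℝ => weight lam s := by
  unfold weight
  fun_prop

theorem measurable_complexKernel (t : Fin (m + 1) → ℂ) :
    Measurable fun s : Fin m → ℝ => complexKernel lam t s := by
  unfold complexKernel
  fun_prop

theorem differentiableOn_complexKernel (s : Fin m → ℝ) :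
    DifferentiableOn ℂ (fun t => complexKernel lam t s) (tube (m + 1) 0) := by
  refine differentiableOn_finsetProd fun j _ => differentiableOn_finsetProd fun k _ => ?_
  refine DifferentiableOn.cpow_const (Differentiable.differentiableOn (by fun_prop)) fun t ht => ?_
  exact two_mul_cosh_mem_slitPlane (by simpa using ht j)

theorem norm_weight (hlam : 0 < lam.re) (s : Fin m → ℝ) :
    ‖weight lam s‖ = pairProd (fun y => (4 * sinh y ^ 2) ^ lam.re) s := by
  simp only [weight, norm_prod, pairProd]
  exact prod_congr rfl fun j _ => prod_congr rfl fun k _ =>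
    Complex.norm_cpow_eq_rpow_re_of_nonneg (by positivity) hlam.ne'

theorem norm_complexKernel_le (hlam : 0 ≤ lam.re) {θ : ℝ} (hθ : θ < π / 2)
    {t : Fin (m + 1) → ℂ} (ht : ∀ j, |(t j).im| ≤ θ) (s : Fin m → ℝ) :
    ‖complexKernel lam t s‖ ≤ coshConst lam θ ^ ((m + 1) * m) *
      exp (-(lam.re * crossDist (fun j => (t j).re) s)) := by
  have factor_le (j : Fin (m + 1)) (k : Fin m) : ‖(2 * Complex.cosh (t j - s k)) ^ (-lam)‖ ≤
      coshConst lam θ * exp (-(lam.re * |(t j).re - s k|)) := by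
    simpa using norm_two_mul_cosh_cpow_le hlam hθ (z := t j - s k) (by simpa using ht j)
  calc ‖complexKernel lam t s‖
      = ∏ j, ∏ k, ‖(2 * Complex.cosh (t j - s k)) ^ (-lam)‖ := by simp_rw [complexKernel, norm_prod]
    _ ≤ ∏ j, ∏ k, coshConst lam θ * exp (-(lam.re * |(t j).re - s k|)) := by
        gcongr
        exact factor_le _ _
    _ = _ := by
        simp_rw [prod_mul_distrib, ← exp_sum, sum_neg_distrib, ← mul_sum, crossDist]
        simp [← pow_mul, mul_comm]

end WeightKernel

/-! ### The recursion in a tube -/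

/-- `realF lam n` is continuous at real points and decays like the product of the functions
`x / sinh (Re lam * x)` of the differences of the coordinates, with constant `B`. This is what the
recursion needs to know about the previous function. -/
structure RealBound (lam : ℂ) (n : ℕ) (B : ℝ) : Prop where
  continuous : ∀ u, Continuous fun s => realF lam n s u
  norm_le : ∀ u s, ‖realF lam n s u‖ ≤ B * pairProd (sinhRatio lam.re) s

theorem RealBound.nonneg {lam : ℂ} {n : ℕ} {B : ℝ} (hB : RealBound lam n B) (hlam : 0 < lam.re) :
    0 ≤ B :=
  nonneg_of_mul_nonneg_left ((norm_nonneg _).trans (hB.norm_le 0 0))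
    (pairProd_pos (sinhRatio_pos hlam))

/-- The integrand of the recursion for `F_{n+2}`, at complex `t`. -/
def integrand (lam : ℂ) {n : ℕ} (u : Fin (n + 2) → ℝ) (t : Fin (n + 2) → ℂ)
    (s : Fin (n + 1) → ℝ) : ℂ :=
  weight lam s * complexKernel lam t s * realF lam n s (shift u)

/-- The recursion for `F_{n+2}` at complex `t`; for `t` in `tube (n + 2) 0` the factors of the
kernel stay away from the branch cut. -/
def tubeF (lam : ℂ) {n : ℕ} (u : Fin (n + 2) → ℝ) (t : Fin (n + 2) → ℂ) : ℂ :=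
  Complex.exp (Complex.I * (u (Fin.last (n + 1)) : ℂ) * ∑ j, t j) / (Nat.factorial (n + 1) : ℂ) *
    ∫ s : Fin (n + 1) → ℝ, integrand lam u t s

section Recursion

variable {lam : ℂ} {n : ℕ} {B : ℝ} (u : Fin (n + 2) → ℝ)

theorem tubeF_ofReal (x : Fin (n + 2) → ℝ) :
    tubeF lam u (fun j => (x j : ℂ)) = realF lam (n + 1) x u := by
  simp [tubeF, realF, integrand, complexKernel_ofReal]

theorem RealBound.aestronglyMeasurable_integrand (hB : RealBound lam n B) (t : Fin (n + 2) → ℂ) :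
    AEStronglyMeasurable (integrand lam u t) :=
  ((measurable_weight.mul (measurable_complexKernel t)).mul
    (hB.continuous (shift u)).measurable).aestronglyMeasurable

theorem RealBound.norm_weight_mul_norm_realF_le (hB : RealBound lam n B) (hlam : 1 ≤ lam.re)
    (v s : Fin (n + 1) → ℝ) :
    ‖weight lam s‖ * ‖realF lam n s v‖ ≤
      B * (pairProd (fun y => 2 * |y|) s * exp (lam.re * pairDist s)) := by
  have hlam0 : 0 < lam.re := by linarith
  rw [← pairProd_exp_abs, ← pairProd_mul]
  calc ‖weight lam s‖ * ‖realF lam n s v‖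
      ≤ ‖weight lam s‖ * (B * pairProd (sinhRatio lam.re) s) := by
        gcongr
        exact hB.norm_le v s
    _ = B * pairProd (fun y => (4 * sinh y ^ 2) ^ lam.re * sinhRatio lam.re y) s := by
        rw [norm_weight hlam0, pairProd_mul]
        ring
    _ ≤ _ := mul_le_mul_of_nonneg_left
        (pairProd_mono (fun y => mul_nonneg (by positivity) (sinhRatio_pos hlam0 y).le)
          (four_mul_sinh_sq_rpow_mul_sinhRatio_le hlam)) (hB.nonneg hlam0)

theorem RealBound.norm_integrand_le (hB : RealBound lam n B) (hlam : 1 ≤ lam.re) {θ : ℝ}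
    (hθ : θ < π / 2) {t : Fin (n + 2) → ℂ} (ht : ∀ j, |(t j).im| ≤ θ) (s : Fin (n + 1) → ℝ) :
    ‖integrand lam u t s‖ ≤ B * coshConst lam θ ^ ((n + 2) * (n + 1)) *
      integrandMajorant lam.re (fun j => (t j).re) s := by
  have hweight := hB.norm_weight_mul_norm_realF_le hlam (shift u) s
  have hkernel := norm_complexKernel_le (by linarith) hθ ht s
  calc ‖integrand lam u t s‖
      = ‖weight lam s‖ * ‖realF lam n s (shift u)‖ * ‖complexKernel lam t s‖ := by
        rw [integrand, norm_mul, norm_mul, mul_right_comm]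
    _ ≤ _ := mul_le_mul hweight hkernel (norm_nonneg _)
        ((mul_nonneg (norm_nonneg _) (norm_nonneg _)).trans hweight)
    _ = _ := by
        rw [integrandMajorant, mul_sub, sub_eq_add_neg, exp_add]
        ring

theorem RealBound.integrable_integrand (hB : RealBound lam n B) (hlam : 1 ≤ lam.re) {θ : ℝ}
    (hθ : θ < π / 2) {t : Fin (n + 2) → ℂ} (ht : ∀ j, |(t j).im| ≤ θ) :
    Integrable (integrand lam u t) :=
  ((integrable_integrandMajorant hlam _).const_mul _).mono' (hB.aestronglyMeasurable_integrand u t)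
    (ae_of_all _ (hB.norm_integrand_le u hlam hθ ht))

theorem exists_eventually_abs_im_le {m : ℕ} {x : Fin m → ℂ} (hx : x ∈ tube m 0) :
    ∃ θ ∈ Set.Ico 0 (π / 2), ∀ᶠ t in nhds x, ∀ j, |(t j).im| ≤ θ := by
  have norm_im_lt : ‖fun j => (x j).im‖ < π / 2 :=
    (pi_norm_lt_iff (half_pos pi_pos)).2 fun j => by simpa using hx j
  obtain ⟨θ, hxθ, hθ⟩ := exists_between norm_im_lt
  have continuous_norm_im : Continuous fun t : Fin m → ℂ => ‖fun j => (t j).im‖ :=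
    (continuous_pi fun j => Complex.continuous_im.comp (continuous_apply j)).norm
  refine ⟨θ, ⟨(norm_nonneg _).trans hxθ.le, hθ⟩, ?_⟩
  filter_upwards [continuous_norm_im.continuousAt.eventually_lt continuousAt_const hxθ] with t ht j
  exact (norm_le_pi_norm (fun j => (t j).im) j).trans ht.le

theorem RealBound.exists_integrable_dominating (hB : RealBound lam n B) (hlam : 1 ≤ lam.re)
    {x : Fin (n + 2) → ℂ} (hx : x ∈ tube (n + 2) 0) :
    ∃ b : (Fin (n + 1) → ℝ) → ℝ, Integrable b ∧
      ∀ᶠ t in nhds x, ∀ s, ‖integrand lam u t s‖ ≤ b s := by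
  have hlam0 : 0 < lam.re := by linarith
  obtain ⟨θ, hθ, him⟩ := exists_eventually_abs_im_le hx
  have hre : ∀ᶠ t in nhds x, ∑ j, |(t j).re - (x j).re| < 1 :=
    (continuous_finsetSum _ fun j _ => ((Complex.continuous_re.comp (continuous_apply j)).sub
      continuous_const).abs).continuousAt.eventually_lt continuousAt_const (by simp)
  refine ⟨fun s => B * coshConst lam θ ^ ((n + 2) * (n + 1)) * (exp (lam.re * ((n + 1 : ℕ) * 1)) *
      integrandMajorant lam.re (fun j => (x j).re) s),
    ((integrable_integrandMajorant hlam _).const_mul _).const_mul _, ?_⟩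
  filter_upwards [him, hre] with t htim htre s
  refine (hB.norm_integrand_le u hlam hθ.2 htim s).trans ?_
  have := hB.nonneg hlam0
  have := coshConst_nonneg lam hθ
  gcongr
  refine (integrandMajorant_le_exp_mul hlam0.le _ (fun j => (x j).re) s).trans ?_
  gcongr
  exact integrandMajorant_nonneg _ _ _

theorem RealBound.differentiableOn_tubeF (hB : RealBound lam n B) (hlam : 1 ≤ lam.re) :
    DifferentiableOn ℂ (tubeF lam u) (tube (n + 2) 0) :=
  (Differentiable.differentiableOn (by fun_prop)).mul <|
    differentiableOn_integral_of_locally_dominated (isOpen_tube _ _)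
      (fun t _ => hB.aestronglyMeasurable_integrand u t)
      (fun s => ((differentiableOn_complexKernel s).const_mul _).mul_const _)
      fun _ => hB.exists_integrable_dominating u hlam

theorem pairProd_pairDecay_le {a : ℝ} (ha : 0 < a) {m : ℕ} (x : Fin m → ℝ) :
    pairProd (pairDecay a) x ≤ (a + 1) ^ m.choose 2 * pairProd (sinhRatio a) x := by
  rw [← pairProd_const_mul]
  exact pairProd_mono (fun y => (pairDecay_pos a y).le) (pairDecay_le_sinhRatio ha)

/-- The constant in the bound for `tubeF`, relative to the constant for the previous function,
where `|Im t_j| ≤ θ`. -/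
def stepConst (n : ℕ) (lam : ℂ) (θ : ℝ) : ℝ :=
  coshConst lam θ ^ ((n + 2) * (n + 1)) *
    (integralConst (n + 1) * (lam.re + 1) ^ (n + 2).choose 2)

theorem RealBound.norm_integral_integrand_le (hB : RealBound lam n B) (hlam : 1 ≤ lam.re) {θ : ℝ}
    (hθ : θ < π / 2) {t : Fin (n + 2) → ℂ} (ht : ∀ j, |(t j).im| ≤ θ) :
    ‖∫ s, integrand lam u t s‖ ≤
      B * stepConst n lam θ * pairProd (sinhRatio lam.re) fun j => (t j).re := by
  have hlam0 : 0 < lam.re := by linarith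
  have := hB.nonneg hlam0
  have := coshConst_nonneg lam ⟨(abs_nonneg _).trans (ht 0), hθ⟩
  have := (integralConst_pos (n + 1)).le
  calc ‖∫ s, integrand lam u t s‖
      ≤ ∫ s : Fin (n + 1) → ℝ, B * coshConst lam θ ^ ((n + 2) * (n + 1)) *
          integrandMajorant lam.re (fun j => (t j).re) s :=
        norm_integral_le_of_norm_le ((integrable_integrandMajorant hlam _).const_mul _)
          (ae_of_all _ (hB.norm_integrand_le u hlam hθ ht))
    _ ≤ B * coshConst lam θ ^ ((n + 2) * (n + 1)) *
          (integralConst (n + 1) * pairProd (pairDecay lam.re) fun j => (t j).re) := by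
        rw [integral_const_mul]
        gcongr
        exact integral_integrandMajorant_le hlam _
    _ ≤ B * coshConst lam θ ^ ((n + 2) * (n + 1)) * (integralConst (n + 1) *
          ((lam.re + 1) ^ (n + 2).choose 2 * pairProd (sinhRatio lam.re) fun j => (t j).re)) := by
        gcongr
        exact pairProd_pairDecay_le hlam0 _
    _ = _ := by
        rw [stepConst]
        ring

theorem norm_tubeF_le_exp_mul_norm_integral (t : Fin (n + 2) → ℂ) :
    ‖tubeF lam u t‖ ≤
      exp (-(u (Fin.last (n + 1)) * ∑ j, (t j).im)) * ‖∫ s, integrand lam u t s‖ := by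
  rw [tubeF, norm_mul, norm_div, Complex.norm_exp, Complex.norm_natCast, mul_assoc,
    Complex.I_mul_re, Complex.im_ofReal_mul, Complex.im_sum]
  gcongr
  exact div_le_self (exp_pos _).le (mod_cast Nat.factorial_pos (n + 1))

end Recursion

/-! ### Translations -/

theorem sum_shift {n : ℕ} (u : Fin (n + 2) → ℝ) :
    ∑ j, shift u j = ∑ j, u j - (n + 2) * u (Fin.last (n + 1)) := by
  rw [Fin.sum_univ_castSucc u]
  simp only [shift, sum_sub_distrib, sum_const, card_univ, Fintype.card_fin, nsmul_eq_mul]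
  push_cast
  ring

section RealTranslation

variable {lam : ℂ} {n : ℕ}

theorem integral_integrand_add_ofReal
    (h : ∀ (u s : Fin (n + 1) → ℝ) (c : ℝ), realF lam n (fun k => s k + c) u =
      Complex.exp (Complex.I * c * ∑ j, (u j : ℂ)) * realF lam n s u)
    (u : Fin (n + 2) → ℝ) (t : Fin (n + 2) → ℂ) (c : ℝ) :
    ∫ s, integrand lam u (fun j => t j + c) s =
      Complex.exp (Complex.I * c * ∑ j, (shift u j : ℂ)) * ∫ s, integrand lam u t s := by
  rw [← integral_add_right_eq_self _ (fun _ => c), ← integral_const_mul]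
  refine integral_congr_ae (ae_of_all _ fun s => ?_)
  change integrand lam u (fun j => t j + c) (fun k => s k + c) = _
  simp only [integrand, weight_add_const, complexKernel_add_const, h]
  exact mul_left_comm _ _ _

theorem tubeF_add_ofReal
    (h : ∀ (u s : Fin (n + 1) → ℝ) (c : ℝ), realF lam n (fun k => s k + c) u =
      Complex.exp (Complex.I * c * ∑ j, (u j : ℂ)) * realF lam n s u)
    (u : Fin (n + 2) → ℝ) (t : Fin (n + 2) → ℂ) (c : ℝ) :
    tubeF lam u (fun j => t j + c) =
      Complex.exp (Complex.I * c * ∑ j, (u j : ℂ)) * tubeF lam u t := by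
  have sum_shift' : ∑ j, (shift u j : ℂ) = ∑ j, (u j : ℂ) - (n + 2) * u (Fin.last (n + 1)) :=
    mod_cast sum_shift u
  have sum_add : ∑ j, (t j + c) = ∑ j, t j + (n + 2) * c := by simp [sum_add_distrib]
  have exponents_add (v : ℂ) : Complex.I * v * (∑ j, t j + (n + 2) * c) =
      Complex.I * c * ∑ j, (u j : ℂ) + Complex.I * v * ∑ j, t j -
        Complex.I * c * (∑ j, (u j : ℂ) - (n + 2) * v) := by ring
  rw [tubeF, tubeF, integral_integrand_add_ofReal h, sum_shift', sum_add, exponents_add,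
    Complex.exp_sub, Complex.exp_add]
  field_simp [Complex.exp_ne_zero]

theorem realF_add_const (u s : Fin (n + 1) → ℝ) (c : ℝ) :
    realF lam n (fun k => s k + c) u =
      Complex.exp (Complex.I * c * ∑ j, (u j : ℂ)) * realF lam n s u := by
  induction n generalizing c with
  | zero =>
    rw [realF, realF, ← Complex.exp_add, Fin.sum_univ_one, Complex.ofReal_add]
    ring_nf
  | succ n ih =>
    rw [← tubeF_ofReal, ← tubeF_ofReal, ← tubeF_add_ofReal ih]
    simp only [Complex.ofReal_add]

end RealTranslation

section ShiftedF

variable {lam : ℂ} {n : ℕ} {B : ℝ} (u : Fin (n + 2) → ℝ)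

theorem RealBound.tubeF_add_const (hB : RealBound lam n B) (hlam : 1 ≤ lam.re)
    {t : Fin (n + 2) → ℂ} {c : ℂ} (ht : t ∈ tube (n + 2) 0)
    (htc : (fun j => t j + c) ∈ tube (n + 2) 0) :
    tubeF lam u (fun j => t j + c) =
      Complex.exp (Complex.I * c * ∑ j, (u j : ℂ)) * tubeF lam u t := by
  let translate (z : ℂ) : Fin (n + 2) → ℂ := fun j => t j + z
  have translate_differentiable : Differentiable ℂ translate := by fun_prop
  have convex_preimage : Convex ℝ (translate ⁻¹' tube (n + 2) 0) :=
    ((convex_tube _ 0).translate_preimage_right t).linear_preimage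
      (LinearMap.pi fun _ => LinearMap.id)
  exact eqOn_of_eq_ofReal ((isOpen_tube _ 0).preimage translate_differentiable.continuous)
    convex_preimage (fun x j => by simpa [translate] using ht j)
    ((hB.differentiableOn_tubeF u hlam).comp translate_differentiable.differentiableOn
      fun _ => id)
    (g := fun z => Complex.exp (Complex.I * z * ∑ j, (u j : ℂ)) * tubeF lam u t)
    (Differentiable.differentiableOn (by fun_prop))
    (tubeF_add_ofReal realF_add_const u t) htc

/-- The translate of `tubeF` to the tube with axis `c`, normalized by the translation covariance
of `F_{n+2}` so that it continues `tubeF`. -/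
def shiftedF (lam : ℂ) {n : ℕ} (u : Fin (n + 2) → ℝ) (c : ℝ) (t : Fin (n + 2) → ℂ) : ℂ :=
  Complex.exp (-(c * ∑ j, (u j : ℂ))) * tubeF lam u fun j => t j - c * Complex.I

theorem shiftedF_zero : shiftedF lam u 0 = tubeF lam u := by
  ext t
  simp [shiftedF]

theorem RealBound.differentiableOn_shiftedF (hB : RealBound lam n B) (hlam : 1 ≤ lam.re) (c : ℝ) :
    DifferentiableOn ℂ (shiftedF lam u c) (tube (n + 2) c) :=
  have translate_differentiable :
      Differentiable ℂ fun (t : Fin (n + 2) → ℂ) j => t j - c * Complex.I := by fun_prop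
  have translate_mapsTo : Set.MapsTo (fun (t : Fin (n + 2) → ℂ) j => t j - c * Complex.I)
      (tube (n + 2) c) (tube (n + 2) 0) := fun _ => mem_tube_iff_sub_mem_tube_zero.1
  ((hB.differentiableOn_tubeF u hlam).comp translate_differentiable.differentiableOn
    translate_mapsTo).const_mul _

theorem RealBound.shiftedF_eq_shiftedF (hB : RealBound lam n B) (hlam : 1 ≤ lam.re) {c c' : ℝ}
    {t : Fin (n + 2) → ℂ} (hc : t ∈ tube (n + 2) c) (hc' : t ∈ tube (n + 2) c') :
    shiftedF lam u c t = shiftedF lam u c' t := by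
  rw [mem_tube_iff_sub_mem_tube_zero] at hc hc'
  have translate : (fun j => t j - c * Complex.I) =
      fun j => (t j - c' * Complex.I) + (c' - c) * Complex.I := by
    ext j
    ring
  rw [shiftedF, shiftedF, translate, hB.tubeF_add_const u hlam hc' (translate ▸ hc), ← mul_assoc,
    ← Complex.exp_add]
  congr 2
  linear_combination (c' - c) * (∑ j, (u j : ℂ)) * Complex.I_sq

end ShiftedF

/-! ### The continuation to `domainA` -/

section DomainA

variable {n : ℕ} {t : Fin (n + 1) → ℂ} {j : Equiv.Perm (Fin (n + 1))}

theorem exists_isImOrdering (t : Fin (n + 1) → ℂ) : ∃ j, IsImOrdering t j :=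
  exists_perm_antitone fun k => (t k).im

theorem ofReal_mem_domainA (x : Fin (n + 1) → ℝ) : (fun j => (x j : ℂ)) ∈ domainA n :=
  fun j k _ => by simpa using pi_pos

theorem abs_im_sub_lt_pi (ht : t ∈ domainA n) (k l : Fin (n + 1)) : |(t k - t l).im| < π := by
  rcases lt_trichotomy k l with h | rfl | h
  · exact ht _ _ h
  · simpa using pi_pos
  · rw [← neg_sub, Complex.neg_im, abs_neg]
    exact ht _ _ h

theorem dist_lt_pi (ht : t ∈ domainA n) (j : Equiv.Perm (Fin (n + 1))) : dist t j < π :=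
  (le_abs_self _).trans_lt (abs_im_sub_lt_pi ht _ _)

theorem IsImOrdering.abs_im_sub_phi_le (hj : IsImOrdering t j) (k : Fin (n + 1)) :
    |(t k).im - phi t j| ≤ dist t j / 2 := by
  have le_first := hj (Fin.zero_le (j.symm k))
  have last_le := hj (Fin.le_last (j.symm k))
  simp only [Equiv.apply_symm_apply] at le_first last_le
  rw [abs_le]
  simp only [phi, dist, Complex.add_im, Complex.sub_im]
  constructor <;> linarith

theorem IsImOrdering.mem_tube (hj : IsImOrdering t j) (ht : t ∈ domainA n) :
    t ∈ tube (n + 1) (phi t j) := fun k =>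
  (hj.abs_im_sub_phi_le k).trans_lt (div_lt_div_of_pos_right (dist_lt_pi ht j) two_pos)

theorem domainA_eq_iUnion_tube (n : ℕ) : domainA n = ⋃ c, tube (n + 1) c := by
  ext t
  refine ⟨fun ht => ?_, fun ht k l _ => ?_⟩
  · obtain ⟨j, hj⟩ := exists_isImOrdering t
    exact Set.mem_iUnion.2 ⟨_, hj.mem_tube ht⟩
  · obtain ⟨c, hc⟩ := Set.mem_iUnion.1 ht
    have := abs_sub_le (t k).im c (t l).im
    rw [Complex.sub_im]
    linarith [hc k, hc l, abs_sub_comm c (t l).im]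

theorem isOpen_domainA (n : ℕ) : IsOpen (domainA n) := by
  rw [domainA_eq_iUnion_tube]
  exact isOpen_iUnion (isOpen_tube _)

theorem convex_domainA (n : ℕ) : Convex ℝ (domainA n) := by
  have domainA_eq : domainA n = ⋂ (k : Fin (n + 1)) (l : Fin (n + 1)) (_ : k < l),
      (Complex.imLm ∘ₗ ((LinearMap.proj k : (Fin (n + 1) → ℂ) →ₗ[ℝ] ℂ) - LinearMap.proj l)) ⁻¹'
        Metric.ball (0 : ℝ) π := by
    ext t
    simp [domainA]
  rw [domainA_eq]
  exact convex_iInter fun k => convex_iInter fun l => convex_iInter fun _ =>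
    (convex_ball 0 π).linear_preimage _

end DomainA

section Continuation

variable {lam : ℂ} {n : ℕ}

theorem IsContinuation.eqOn {u : Fin (n + 1) → ℝ} {G H : (Fin (n + 1) → ℂ) → ℂ}
    (hG : IsContinuation lam n u G) (hH : IsContinuation lam n u H) : Set.EqOn G H (domainA n) :=
  eqOn_pi_of_eq_ofReal (isOpen_domainA n) (convex_domainA n) ofReal_mem_domainA hG.1 hH.1
    fun x => (hG.2 x).trans (hH.2 x).symm

theorem IsContinuation.isContinuation_F {u : Fin (n + 1) → ℝ} {G : (Fin (n + 1) → ℂ) → ℂ}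
    (hG : IsContinuation lam n u G) : IsContinuation lam n u fun t => F lam n t u := by
  have h : ∃ G, IsContinuation lam n u G := ⟨G, hG⟩
  simp only [F, dif_pos h]
  exact h.choose_spec

theorem RealBound.exists_isContinuation {B : ℝ} (hB : RealBound lam n B) (hlam : 1 ≤ lam.re)
    (u : Fin (n + 2) → ℝ) :
    ∃ G, IsContinuation lam (n + 1) u G ∧ ∀ c, Set.EqOn G (shiftedF lam u c) (tube (n + 2) c) := by
  choose! axis mem_tube_axis using fun t (ht : ∃ c, t ∈ tube (n + 2) c) => ht
  have eqOn (c : ℝ) :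
      Set.EqOn (fun t => shiftedF lam u (axis t) t) (shiftedF lam u c) (tube (n + 2) c) :=
    fun t ht => hB.shiftedF_eq_shiftedF u hlam (mem_tube_axis t ⟨c, ht⟩) ht
  have ofReal_mem_tube (x : Fin (n + 2) → ℝ) : (fun j => (x j : ℂ)) ∈ tube (n + 2) 0 := fun j => by
    simpa using pi_pos
  refine ⟨_, ⟨?_, fun x => ?_⟩, eqOn⟩
  · rw [domainA_eq_iUnion_tube]
    exact DifferentiableOn.iUnion_of_isOpen
      (fun c => (hB.differentiableOn_shiftedF u hlam c).congr (eqOn c)) (isOpen_tube _)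
  · exact (eqOn 0 (ofReal_mem_tube x)).trans (shiftedF_zero u ▸ tubeF_ofReal u x)

end Continuation

/-! ### The bound -/

theorem sum_eq_add_add_sum_Ioo {M : Type*} [AddCommMonoid M] {n : ℕ} (f : Fin (n + 2) → M) :
    ∑ k, f k = f 0 + f (Fin.last (n + 1)) + ∑ k ∈ Ioo 0 (Fin.last (n + 1)), f k := by
  have univ_eq : (univ : Finset (Fin (n + 2))) = Icc 0 (Fin.last (n + 1)) :=
    (Icc_bot_top (α := Fin (n + 2))).symm
  rw [univ_eq, ← Ioc_insert_left (Fin.zero_le _), ← Ioo_insert_right (Fin.last_pos),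
    sum_insert (by simp [Fin.ext_iff]), sum_insert (by simp), ← add_assoc]

theorem sum_im_sub_phi {n : ℕ} (t : Fin (n + 2) → ℂ) (j : Equiv.Perm (Fin (n + 2))) :
    ∑ k, ((t k).im - phi t j) =
      ∑ k ∈ Ioo 0 (Fin.last (n + 1)), ((t (j k)).im - phi t j) := by
  rw [← Equiv.sum_comp j, sum_eq_add_add_sum_Ioo]
  simp only [phi, Complex.add_im]
  ring

theorem RealBound.norm_shiftedF_phi_le {lam : ℂ} {n : ℕ} {B : ℝ} (hB : RealBound lam n B)
    (hlam : 1 ≤ lam.re) (u : Fin (n + 2) → ℝ) {t : Fin (n + 2) → ℂ} (ht : t ∈ domainA (n + 1))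
    {j : Equiv.Perm (Fin (n + 2))} (hj : IsImOrdering t j) :
    ‖shiftedF lam u (phi t j) t‖ ≤ B * stepConst n lam (dist t j / 2) *
      exp (-(phi t j * ∑ k, u k + u (Fin.last (n + 1)) *
        ∑ k ∈ Ioo 0 (Fin.last (n + 1)), ((t (j k)).im - phi t j))) *
      pairProd (sinhRatio lam.re) fun k => (t k).re := by
  have im_translate (k : Fin (n + 2)) :
      (t k - phi t j * Complex.I).im = (t k).im - phi t j := by simp
  have re_translate (k : Fin (n + 2)) : (t k - phi t j * Complex.I).re = (t k).re := by simp
  have norm_phase : ‖Complex.exp (-(phi t j * ∑ k, (u k : ℂ)))‖ = exp (-(phi t j * ∑ k, u k)) := by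
    rw [Complex.norm_exp]
    norm_cast
  have norm_integral_le := hB.norm_integral_integrand_le u hlam
    (div_lt_div_of_pos_right (dist_lt_pi ht j) two_pos)
    (t := fun k => t k - phi t j * Complex.I)
    fun k => (im_translate k).symm ▸ hj.abs_im_sub_phi_le k
  have norm_tubeF_le := norm_tubeF_le_exp_mul_norm_integral (lam := lam) u
    fun k => t k - phi t j * Complex.I
  simp only [im_translate, re_translate, sum_im_sub_phi] at norm_tubeF_le norm_integral_le
  rw [shiftedF, norm_mul, norm_phase, neg_add, exp_add]
  grw [norm_tubeF_le, norm_integral_le]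
  exact le_of_eq (by ring)

/-- The analytic facts about `F_{n+1}` at the parameter `lam`, with `C` the prefactor of the upper
bound as a function of `d_{n+1}(t)`; the induction is on `n`. -/
structure HolomorphicBound (lam : ℂ) (n : ℕ) (C : ℝ → ℝ) : Prop where
  converges : ∀ x u, DefiningIntegralConverges lam n x u
  isContinuation : ∀ u, IsContinuation lam n u fun t => F lam n t u
  norm_lt : ∀ u, ∀ t ∈ domainA n, ∀ j, IsImOrdering t j →
    ‖F lam n t u‖ < C (dist t j) * exp (-(phi t j * ∑ k, u k +
      u (Fin.last n) * ∑ k ∈ Ioo 0 (Fin.last n), ((t (j k)).im - phi t j))) *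
      pairProd (sinhRatio lam.re) fun k => (t k).re

theorem holomorphicBound_zero (lam : ℂ) : HolomorphicBound lam 0 fun _ => 2 := by
  have isContinuation_exp (u : Fin 1 → ℝ) :
      IsContinuation lam 0 u fun t => Complex.exp (Complex.I * t 0 * u 0) :=
    ⟨Differentiable.differentiableOn (by fun_prop), fun _ => rfl⟩
  have isContinuation_F u := (isContinuation_exp u).isContinuation_F
  refine ⟨fun _ _ => trivial, isContinuation_F, fun u t ht j _ => ?_⟩
  have F_eq : F lam 0 t u = _ := (isContinuation_F u).eqOn (isContinuation_exp u) ht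
  have phi_eq : phi t j = (t 0).im := by simp [phi, Subsingleton.elim _ (0 : Fin 1)]
  have norm_F : ‖F lam 0 t u‖ = exp (-((t 0).im * u 0)) := by simp [F_eq, Complex.norm_exp]
  rw [norm_F, phi_eq]
  simpa [pairProd] using lt_two_mul_self (exp_pos _)

theorem HolomorphicBound.realBound {lam : ℂ} {n : ℕ} {C : ℝ → ℝ} (h : HolomorphicBound lam n C) :
    RealBound lam n (C 0) where
  continuous u := by
    refine ((h.isContinuation u).1.continuousOn.comp_continuous
      (f := fun (x : Fin (n + 1) → ℝ) j => (x j : ℂ)) (by fun_prop) ofReal_mem_domainA).congr ?_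
    exact (h.isContinuation u).2
  norm_le u x := by
    have norm_lt := h.norm_lt u _ (ofReal_mem_domainA x) (Equiv.refl _) fun _ _ _ => by simp
    have F_eq : F lam n (fun j => (x j : ℂ)) u = realF lam n x u := (h.isContinuation u).2 x
    simpa [F_eq, phi, dist] using norm_lt.le

theorem HolomorphicBound.succ {lam : ℂ} {n : ℕ} {C : ℝ → ℝ} (h : HolomorphicBound lam n C)
    (hlam : 1 ≤ lam.re) :
    HolomorphicBound lam (n + 1) fun d => 1 + C 0 * stepConst n lam (d / 2) := by
  have hB := h.realBound
  choose G isContinuation_G G_eqOn using hB.exists_isContinuation hlam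
  refine ⟨fun x u => ?_, fun u => (isContinuation_G u).isContinuation_F, fun u t ht j hj => ?_⟩
  · have := hB.integrable_integrand u hlam (half_pos pi_pos) (t := fun j => (x j : ℂ)) (by simp)
    exact this.congr (ae_of_all _ fun s => by simp only [integrand, complexKernel_ofReal])
  · have F_eq : F lam (n + 1) t u = shiftedF lam u (phi t j) t :=
      ((isContinuation_G u).isContinuation_F.eqOn (isContinuation_G u) ht).trans
        (G_eqOn u _ (hj.mem_tube ht))
    rw [F_eq]
    refine (hB.norm_shiftedF_phi_le hlam u ht hj).trans_lt ?_
    have := pairProd_pos (x := fun k => (t k).re) (sinhRatio_pos (by linarith : 0 < lam.re))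
    gcongr
    exact lt_one_add _

/-- The prefactor of the upper bound for `F_{n+1}`. The summand `1` only serves to make the
inequality strict. -/
def boundConst : ℕ → ℂ → ℝ → ℝ
  | 0, _, _ => 2
  | n + 1, lam, d => 1 + boundConst n lam 0 * stepConst n lam (d / 2)

theorem holomorphicBound_boundConst {lam : ℂ} (hlam : 1 ≤ lam.re) (n : ℕ) :
    HolomorphicBound lam n (boundConst n lam) := by
  induction n with
  | zero => exact holomorphicBound_zero lam
  | succ n ih => exact ih.succ hlam

theorem continuousOn_stepConst (n : ℕ) :
    ContinuousOn (fun p : ℂ × ℝ => stepConst n p.1 p.2) (Set.univ ×ˢ Set.Ico 0 (π / 2)) := by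
  unfold stepConst coshConst
  refine ContinuousOn.mul (ContinuousOn.pow (ContinuousOn.mul (ContinuousOn.rpow (by fun_prop)
    (by fun_prop) fun p hp => Or.inl ?_) (by fun_prop)) _) (by fun_prop)
  exact (cos_pos_of_mem_Ioo ⟨by linarith [pi_pos, hp.2.1], hp.2.2⟩).ne'

theorem continuousOn_boundConst (n : ℕ) :
    ContinuousOn (fun p : ℂ × ℝ => boundConst n p.1 p.2) (Set.univ ×ˢ Set.Ico 0 π) := by
  induction n with
  | zero => exact continuousOn_const
  | succ n ih =>
    have continuousOn_zero : ContinuousOn (fun p : ℂ × ℝ => boundConst n p.1 0)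
        (Set.univ ×ˢ Set.Ico 0 π) :=
      ih.comp (f := fun p : ℂ × ℝ => (p.1, (0 : ℝ))) (by fun_prop)
        fun p _ => ⟨trivial, le_rfl, pi_pos⟩
    have continuousOn_half : ContinuousOn (fun p : ℂ × ℝ => stepConst n p.1 (p.2 / 2))
        (Set.univ ×ˢ Set.Ico 0 π) :=
      (continuousOn_stepConst n).comp (f := fun p : ℂ × ℝ => (p.1, p.2 / 2)) (by fun_prop)
        fun p hp => ⟨trivial, by linarith [hp.2.1], by linarith [hp.2.2]⟩
    exact continuousOn_const.add (continuousOn_zero.mul continuousOn_half)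

end

end CalogeroMoser

theorem theorem6p3 (n : ℕ) :
    ∃ C : ℂ → ℝ → ℝ,
      ContinuousOn (fun p : ℂ × ℝ => C p.1 p.2)
        ({lam : ℂ | 1 ≤ lam.re} ×ˢ Set.Ico (0 : ℝ) Real.pi) ∧
      ∀ (u : Fin (n + 1) → ℝ) (lam : ℂ), 1 ≤ lam.re →
        (∀ x : Fin (n + 1) → ℝ, CalogeroMoser.DefiningIntegralConverges lam n x u) ∧
        CalogeroMoser.IsContinuation lam n u (fun t => CalogeroMoser.F lam n t u) ∧
        ∀ t ∈ CalogeroMoser.domainA n, ∀ j : Equiv.Perm (Fin (n + 1)),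
          CalogeroMoser.IsImOrdering t j →
          ‖CalogeroMoser.F lam n t u‖ <
            C lam (CalogeroMoser.dist t j) *
              Real.exp (-(CalogeroMoser.phi t j * ∑ k, u k +
                u (Fin.last n) *
                  ∑ k ∈ Finset.Ioo 0 (Fin.last n),
                    ((t (j k)).im - CalogeroMoser.phi t j))) *
              ∏ k : Fin (n + 1), ∏ l ∈ Finset.Ioi k,
                CalogeroMoser.sinhRatio lam.re (t k - t l).re := by
  refine ⟨CalogeroMoser.boundConst n,
    (CalogeroMoser.continuousOn_boundConst n).mono
      (Set.prod_mono_left (Set.subset_univ _)), fun u lam hlam => ?_⟩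
  have h := CalogeroMoser.holomorphicBound_boundConst hlam n
  exact ⟨fun x => h.converges x u, h.isContinuation u, h.norm_lt u⟩
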